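/- Let $X\subset\mathbb C$ be a nonempty compact set and let $f\colon X\to X$ be a continuous map which extends to a holomorphic map $f\colon W'\to W$ between open neighborhoods $W',W\subset\mathbb C$ of $X$, such that $f^{-1}(X)=\{z\in W': f(z)\in X\}=X$ and $\deg f|_X=N\ge 2$, i.e. every $x\in X$ has exactly $N$ preimages in $W'$ counted with multiplicity. Let $h_{top}(f)$ denote the topological entropy of $f\colon X\to X$. (1) If $X$ is not equal to the union of the cycles of $f\colon X\to X$ that contain a critical point (a point where $f'=0$), then $h_{top}(f)\ge\log N$. (2) If, additionally, $f\colon W'\to W$ is a proper map of degree $N$ (so that every $w\in W$ has exactly $N$ preimages in $W'$ counted with multiplicity), $W$ is (connected and) simply connected, and $W'$ has finitely many connected components, each of them simply connected, then (without the assumption on $X$ made in (1)) $h_{top}(f)\ge\log N$, unless $W'$ is connected and simply connected and $X=\{c\}$ for a fixed critical point $c$ of $f$ of multiplicity $N$ (i.e. $f(c)=c$ and $f(z)-c$ vanishes to order exactly $N$ at $c$). -/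

import Mathlib

/-- The map `g : W' → ℂ` has degree `N` over the set `Y`: every point of `Y` has finitely many
preimages in `W'`, and exactly `N` of them when each preimage is counted with its multiplicity
(the order of vanishing of `w ↦ g w - y` at that preimage). -/
def HasDegreeOver (g : ℂ → ℂ) (W' Y : Set ℂ) (N : ℕ) : Prop :=
  ∀ y ∈ Y, {z ∈ W' | g z = y}.Finite ∧
    ∑ᶠ z ∈ {z ∈ W' | g z = y}, analyticOrderNatAt (fun w => g w - y) z = N

/-- The union of the cycles of `f : X → X` that contain a critical point of `g`, where
`g` is a holomorphic extension of `f` to a neighbourhood of `X`. -/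
def unionOfCriticalCycles {X : Set ℂ} (f : X → X) (g : ℂ → ℂ) : Set X :=
  {x | ∃ c : X, deriv g (c : ℂ) = 0 ∧ c ∈ Function.periodicPts f ∧ ∃ k : ℕ, f^[k] c = x}

/-- `W'` has finitely many connected components and each of them is simply connected. -/
def HasFinitelyManySimplyConnectedComponents (W' : Set ℂ) : Prop :=
  {U : Set ℂ | ∃ z ∈ W', U = connectedComponentIn W' z}.Finite ∧
    ∀ z ∈ W', IsSimplyConnected (connectedComponentIn W' z)

/-! For (1), count backward orbits of a point `x` outside the critical cycles. Off a neighbourhood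
`U` of the finitely many critical points in `X`, `f` is locally injective, so a point with no
preimage in `U` has `N` uniformly separated preimages. If there is a preimage in `U`, only that one
is kept, at the cost of a factor `N`. Backward orbits of `x` rarely visit `U`: returns near a
nonperiodic critical point take long, while a periodic one is superattracting, so an orbit coming
near it is soon too close to its cycle to reach `x`. Hence about `N ^ ((1 - ε) * n)` separated
orbits of length `n` survive (`exists_separated_preimages`, `exists_nhds_visitCount_le_mul_add`,
`log_le_coverEntropy`).

For (2), if the bound fails then by (1) every point of `X` is periodic, so `f` is injective and each
point of `X` is alone in its fibre. Such a fibre makes `W'` connected, since every component of `W'`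
maps onto `W`. By `eq_of_totally_ramified` there is only one such fibre: `g - g x₁` has a
holomorphic `N`-th root, which by properness fills the whole preimage of `W` under `s ↦ s ^ N + g
x₁`, so every other fibre has several points. -/

open Filter Topology

/-! ### Entropy from separated backward orbits -/

/-- The number of times `k < n` at which the orbit of `z` under `f` is in `U`. -/
noncomputable def visitCount {X : Type*} (f : X → X) (U : Set X) (n : ℕ) (z : X) : ℕ :=
  {k | k < n ∧ f^[k] z ∈ U}.ncard

lemma finite_visits {X : Type*} (f : X → X) (U : Set X) (n : ℕ) (z : X) :
    {k | k < n ∧ f^[k] z ∈ U}.Finite :=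
  (Set.finite_lt_nat n).subset fun _ hk => hk.1

lemma visitCount_le_succ {X : Type*} (f : X → X) (U : Set X) (n : ℕ) (z : X) :
    visitCount f U n z ≤ visitCount f U (n + 1) z :=
  Set.ncard_le_ncard (fun _ hk => ⟨hk.1.trans n.lt_succ_self, hk.2⟩) (finite_visits f U _ z)

lemma visitCount_succ_of_mem {X : Type*} (f : X → X) (U : Set X) (n : ℕ) (z : X)
    (h : f^[n] z ∈ U) : visitCount f U (n + 1) z = visitCount f U n z + 1 := by
  rw [visitCount, visitCount, ← Set.ncard_insert_of_notMem (a := n) (by simp)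
    (finite_visits f U n z)]
  congr 1
  ext k
  simp only [Set.mem_ofPred_eq, Set.mem_insert_iff]
  constructor
  · rintro ⟨h1, h2⟩
    rcases Nat.lt_succ_iff_lt_or_eq.mp h1 with h | h
    · exact Or.inr ⟨h, h2⟩
    · exact Or.inl h
  · rintro (rfl | ⟨h1, h2⟩)
    · exact ⟨k.lt_succ_self, h⟩
    · exact ⟨h1.trans n.lt_succ_self, h2⟩

/-- If every point has either a preimage in `U` or `N` preimages that are `δ`-separated, then a
point whose backward orbits of length `n` visit `U` at most `b` times has at least `N ^ (n - b)`
preimages under `f^[n]` which are `(n, δ)`-separated. -/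
lemma exists_separated_preimages {X : Type*} [PseudoMetricSpace X] (f : X → X) (U : Set X) {N : ℕ}
    (hN : 0 < N) {δ : ℝ}
    (hbr : ∀ x, (∃ z ∈ U, f z = x) ∨ ∃ s : Finset X, s.card = N ∧ (∀ z ∈ s, f z = x) ∧
      ∀ z ∈ s, ∀ z' ∈ s, z ≠ z' → δ ≤ dist z z') (n : ℕ) :
    ∀ (b : ℕ) (x : X), (∀ z, f^[n] z = x → visitCount f U n z ≤ b) →
      ∃ S : Finset X, (∀ z ∈ S, f^[n] z = x) ∧
        (∀ z ∈ S, ∀ z' ∈ S, z ≠ z' → ∃ k < n, δ ≤ dist (f^[k] z) (f^[k] z')) ∧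
        N ^ n ≤ S.card * N ^ b := by
  classical
  induction n with
  | zero =>
    intro b x _
    refine ⟨{x}, by simp, by simp, ?_⟩
    simpa using Nat.one_le_pow b N hN
  | succ n ih =>
    intro b x hb
    rcases hbr x with ⟨w, hwU, rfl⟩ | ⟨s, hcard, hs, hsep⟩
    · have hb' : ∀ z, f^[n] z = w → visitCount f U n z + 1 ≤ b := fun z hz => by
        rw [← visitCount_succ_of_mem f U n z (hz ▸ hwU)]
        exact hb z (by rw [Function.iterate_succ_apply', hz])
      obtain ⟨S, h1, h2, h3⟩ := ih (b - 1) w fun z hz => Nat.le_sub_one_of_lt (hb' z hz)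
      refine ⟨S, fun z hz => by rw [Function.iterate_succ_apply', h1 z hz], fun z hz z' hz' hne =>
        let ⟨k, hk, hd⟩ := h2 z hz z' hz' hne
        ⟨k, hk.trans n.lt_succ_self, hd⟩, ?_⟩
      -- The truncated `b - 1` must be a true predecessor: a point of `S` exhibits a visit to `U`,
      -- so `1 ≤ b`.
      have hS : S.Nonempty := by
        rw [Finset.nonempty_iff_ne_empty]
        rintro rfl
        simp at h3
        omega
      obtain ⟨z, hz⟩ := hS
      have hb1 := hb' z (h1 z hz)
      obtain ⟨b, rfl⟩ : ∃ b', b = b' + 1 := ⟨b - 1, by omega⟩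
      rw [Nat.add_sub_cancel] at h3
      rw [pow_succ, pow_succ, ← mul_assoc]
      exact Nat.mul_le_mul_right _ h3
    · have key : ∀ w : X, ∃ S : Finset X, w ∈ s → (∀ z ∈ S, f^[n] z = w) ∧
          (∀ z ∈ S, ∀ z' ∈ S, z ≠ z' → ∃ k < n, δ ≤ dist (f^[k] z) (f^[k] z')) ∧
          N ^ n ≤ S.card * N ^ b := fun w => by
        by_cases hw : w ∈ s
        · obtain ⟨S, hS⟩ := ih b w fun z hz => (visitCount_le_succ f U n z).trans
            (hb z (by rw [Function.iterate_succ_apply', hz, hs w hw]))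
          exact ⟨S, fun _ => hS⟩
        · exact ⟨∅, fun h => absurd h hw⟩
      choose S hS using key
      refine ⟨s.biUnion S, ?_, ?_, ?_⟩
      · intro z hz
        obtain ⟨w, hw, hz⟩ := Finset.mem_biUnion.mp hz
        rw [Function.iterate_succ_apply', (hS w hw).1 z hz, hs w hw]
      · intro z hz z' hz' hne
        obtain ⟨w, hw, hz⟩ := Finset.mem_biUnion.mp hz
        obtain ⟨w', hw', hz'⟩ := Finset.mem_biUnion.mp hz'
        by_cases hww : w = w'
        · subst hww
          obtain ⟨k, hk, hd⟩ := (hS w hw).2.1 z hz z' hz' hne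
          exact ⟨k, hk.trans n.lt_succ_self, hd⟩
        · refine ⟨n, n.lt_succ_self, ?_⟩
          rw [(hS w hw).1 z hz, (hS w' hw').1 z' hz']
          exact hsep w hw w' hw' hww
      · rw [Finset.card_biUnion, Finset.sum_mul, pow_succ, mul_comm]
        · rw [← hcard] at hS ⊢
          exact Finset.card_nsmul_le_sum s _ _ fun w hw => (hS w hw).2.2
        · intro w hw w' hw' hww
          refine Finset.disjoint_left.mpr fun z hz hz' => ?_
          exact hww (((hS w hw).1 z hz).symm.trans ((hS w' hw').1 z hz'))

lemma visitCount_biUnion_le {X ι : Type*} (f : X → X) (s : Finset ι) (U : ι → Set X) (n : ℕ)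
    (z : X) : visitCount f (⋃ i ∈ s, U i) n z ≤ ∑ i ∈ s, visitCount f (U i) n z := by
  refine le_trans (Set.ncard_le_ncard ?_ ?_) (Finset.set_ncard_biUnion_le s _)
  · rintro k ⟨hk, h⟩
    simp only [Set.mem_iUnion] at h ⊢
    obtain ⟨i, hi, h⟩ := h
    exact ⟨i, hi, hk, h⟩
  · exact s.finite_toSet.biUnion fun i _ => finite_visits f (U i) n z

lemma eventually_exp_mul_le {a c C : ℝ} (hca : c < a) : ∀ᶠ n : ℕ in atTop, c * n ≤ a * n - C := by
  filter_upwards [tendsto_natCast_atTop_atTop.eventually_ge_atTop (C / (a - c))] with n hn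
  rw [div_le_iff₀ (by linarith)] at hn
  linarith

/-- A lower bound of the topological entropy by the growth of separated sets. -/
lemma le_coverEntropy_of_separated {X : Type*} [PseudoMetricSpace X] (f : X → X) {a δ C : ℝ}
    (hδ : 0 < δ)
    (h : ∀ n : ℕ, ∃ S : Finset X,
      (∀ z ∈ S, ∀ z' ∈ S, z ≠ z' → ∃ k < n, δ ≤ dist (f^[k] z) (f^[k] z')) ∧
      Real.exp (a * n - C) ≤ S.card) :
    (a : EReal) ≤ Dynamics.coverEntropy f Set.univ := by
  refine le_trans ?_ (Dynamics.netEntropyEntourage_le_coverEntropy (T := f) (F := Set.univ)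
    (Metric.dist_mem_uniformity (half_pos hδ)))
  refine ExpGrowth.le_expGrowthSup_iff.mpr fun b hb => Eventually.frequently ?_
  obtain ⟨c, hbc, hca⟩ := EReal.lt_iff_exists_real_btwn.mp hb
  filter_upwards [eventually_exp_mul_le (C := C) (EReal.coe_lt_coe_iff.mp hca)] with n hn
  obtain ⟨S, hS, hcard⟩ := h n
  -- Points whose dynamical balls of radius `δ / 2` meet stay less than `δ` apart before time `n`.
  have hnet : Dynamics.IsDynNetIn f Set.univ {p : X × X | dist p.1 p.2 < δ / 2} n (S : Set X) := by
    refine ⟨Set.subset_univ _, fun z hz z' hz' hne => Set.disjoint_left.mpr fun y hy hy' => ?_⟩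
    obtain ⟨k, hk, hd⟩ := hS z hz z' hz' hne
    have h1 : dist (f^[k] z) (f^[k] y) < δ / 2 := Dynamics.mem_ball_dynEntourage.mp hy k hk
    have h2 : dist (f^[k] z') (f^[k] y) < δ / 2 := Dynamics.mem_ball_dynEntourage.mp hy' k hk
    linarith [dist_triangle_right (f^[k] z) (f^[k] z') (f^[k] y)]
  have h1 : ((S.card : ℕ∞) : ENNReal) ≤ Dynamics.netMaxcard f Set.univ
      {p : X × X | dist p.1 p.2 < δ / 2} n := ENat.toENNReal_mono hnet.card_le_netMaxcard
  refine le_trans ?_ h1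
  have h2 : EReal.exp (b * n) ≤ EReal.exp ((c * n : ℝ) : EReal) := by
    refine EReal.exp_monotone ?_
    rw [EReal.coe_mul]
    exact mul_le_mul_of_nonneg_right hbc.le (by positivity)
  refine h2.trans ?_
  rw [EReal.exp_coe]
  refine (ENNReal.ofReal_le_ofReal ((Real.exp_le_exp.mpr hn).trans hcard)).trans ?_
  simp

/-- The topological entropy is at least `log N` if, up to sets `U` that backward orbits of `x`
visit with arbitrarily small frequency, every point has `N` uniformly separated preimages. -/
lemma log_le_coverEntropy {X : Type*} [PseudoMetricSpace X] (f : X → X) {N : ℕ}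
    (hN : 2 ≤ N) (x : X)
    (h : ∀ ε : ℝ, 0 < ε → ∃ (U : Set X) (C : ℕ),
      (∀ n z, f^[n] z = x → (visitCount f U n z : ℝ) ≤ ε * n + C) ∧
      ∃ δ > 0, ∀ x, (∃ z ∈ U, f z = x) ∨ ∃ s : Finset X, s.card = N ∧ (∀ z ∈ s, f z = x) ∧
        ∀ z ∈ s, ∀ z' ∈ s, z ≠ z' → δ ≤ dist z z') :
    ((Real.log N : ℝ) : EReal) ≤ Dynamics.coverEntropy f Set.univ := by
  have hlog : 0 < Real.log N := Real.log_pos (by exact_mod_cast hN)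
  have hN0 : (0 : ℝ) < N := by positivity
  refine EReal.ge_of_forall_gt_iff_ge.mp fun c hc => ?_
  have hc : c < Real.log N := EReal.coe_lt_coe_iff.mp hc
  -- This `ε` gives `N ^ ((1 - ε) * n) = exp (c * n)`; rounding the visit bound up costs one more
  -- `log N`.
  obtain ⟨U, C, hU, δ, hδ, hbr⟩ := h ((Real.log N - c) / Real.log N)
    (div_pos (by linarith) hlog)
  refine le_coverEntropy_of_separated f (C := (C + 1) * Real.log N) hδ fun n => ?_
  set ε := (Real.log N - c) / Real.log N with hε
  have hε' : ε * Real.log N = Real.log N - c := div_mul_cancel₀ _ hlog.ne'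
  have hε0 : 0 < ε := div_pos (by linarith) hlog
  obtain ⟨S, -, hsep, hcard⟩ := exists_separated_preimages f U (by omega) hbr n
    ⌈ε * n + C⌉₊ x fun z hz => by
      exact_mod_cast (hU n z hz).trans (Nat.le_ceil _)
  refine ⟨S, hsep, ?_⟩
  have hcard' : (N : ℝ) ^ n ≤ S.card * (N : ℝ) ^ ⌈ε * n + C⌉₊ := by exact_mod_cast hcard
  have hceil : (⌈ε * n + C⌉₊ : ℝ) ≤ ε * n + C + 1 := (Nat.ceil_lt_add_one (by positivity)).le
  refine le_of_mul_le_mul_right (le_trans ?_ hcard') (pow_pos hN0 ⌈ε * n + C⌉₊)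
  rw [← Real.exp_log (pow_pos hN0 ⌈ε * n + C⌉₊), ← Real.exp_log (pow_pos hN0 n), ← Real.exp_add,
    Real.exp_le_exp, Real.log_pow, Real.log_pow]
  have := mul_le_mul_of_nonneg_right hceil hlog.le
  nlinarith [mul_comm (n : ℝ) (ε * Real.log N)]

/-! ### Frequency of visits near critical points -/

/-- Near a point that is not periodic, orbits return with small frequency. -/
lemma exists_nhds_visitCount_le_of_not_periodic {X : Type*} [TopologicalSpace X] [T2Space X]
    {f : X → X} (hf : Continuous f) {c : X} (hc : c ∉ Function.periodicPts f) {T : ℕ}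
    (hT : 0 < T) : ∃ U ∈ 𝓝 c, ∀ n z, visitCount f U n z ≤ n / T + 1 := by
  have h1 : ∀ k : ℕ, ∃ V ∈ 𝓝 c, 0 < k → ∀ z ∈ V, f^[k] z ∉ V := fun k => by
    rcases Nat.eq_zero_or_pos k with rfl | hk
    · exact ⟨Set.univ, univ_mem, fun h => absurd h (lt_irrefl _)⟩
    · have hne : c ≠ f^[k] c := fun h => hc ⟨k, hk, h.symm⟩
      obtain ⟨A, hA, B, hB, hAB⟩ := Filter.disjoint_iff.mp (disjoint_nhds_nhds.mpr hne)
      exact ⟨A ∩ f^[k] ⁻¹' B, inter_mem hA ((hf.iterate k).continuousAt hB), fun _ z hz hz' =>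
        Set.disjoint_left.mp hAB hz'.1 hz.2⟩
  choose V hV hVk using h1
  refine ⟨⋂ k ∈ Finset.range T, V k, (biInter_finset_mem _).mpr fun k _ => hV k, fun n z => ?_⟩
  -- Two visits with equal `k / T` would be a return in fewer than `T` steps, so `k ↦ k / T` is
  -- injective on visit times.
  rw [visitCount, ← Set.InjOn.ncard_image (f := fun k => k / T), ← Finset.card_range (n / T + 1),
    ← Set.ncard_coe_finset]
  · refine Set.ncard_le_ncard ?_ (Finset.finite_toSet _)
    rintro _ ⟨k, ⟨hk, -⟩, rfl⟩
    simpa [Nat.lt_succ_iff] using Nat.div_le_div_right hk.le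
  · suffices H : ∀ k l, f^[k] z ∈ ⋂ k ∈ Finset.range T, V k →
        f^[l] z ∈ ⋂ k ∈ Finset.range T, V k → k / T = l / T → ¬ k < l by
      intro k hk l hl hkl
      have h1 := H k l hk.2 hl.2 hkl
      have h2 := H l k hl.2 hk.2 hkl.symm
      omega
    intro k l hk hl hkl hlt
    have hlT : l - k < T := by
      have h1 := Nat.div_add_mod k T
      have h2 := Nat.div_add_mod l T
      have h3 := Nat.mod_lt l hT
      rw [hkl] at h1
      omega
    have hmem : l - k ∈ Finset.range T := Finset.mem_range.mpr hlT
    refine hVk (l - k) (by omega) (f^[k] z) (Set.mem_iInter₂.mp hk _ hmem) ?_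
    rw [← Function.iterate_add_apply, Nat.sub_add_cancel hlt.le]
    exact Set.mem_iInter₂.mp hl _ hmem

/-- Backward orbits of a point outside an attracting cycle spend a bounded time near the cycle. -/
lemma exists_nhds_visitCount_le_of_attracting {X : Type*} [MetricSpace X]
    {f : X → X} (hf : Continuous f) {c x : X} {p : ℕ} (hp : 0 < p)
    (hattr : ∀ᶠ z in 𝓝 c, dist (f^[p] z) c ≤ dist z c / 2) (hx : ∀ k, f^[k] c ≠ x) :
    ∃ U ∈ 𝓝 c, ∃ C, ∀ n z, f^[n] z = x → visitCount f U n z ≤ C := by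
  obtain ⟨r, hr, hball⟩ := Metric.eventually_nhds_iff.mp hattr
  have h1 : ∀ᶠ w in 𝓝 c, ∀ j ∈ Finset.range p, f^[j] w ≠ x :=
    (eventually_all_finset _).mpr fun j _ => (hf.iterate j).continuousAt.eventually_ne (hx j)
  obtain ⟨ρ, hρ, hne⟩ := Metric.eventually_nhds_iff.mp h1
  -- `Q` halvings shrink radius `r` below `ρ`, where `f^[j]` avoids `x` for all `j < p`. So visits
  -- to the `r`-ball can occur only in the last `p * Q` steps before `x`.
  obtain ⟨Q, hQ⟩ := exists_pow_lt_of_lt_one (div_pos hρ hr) (by norm_num : (1 / 2 : ℝ) < 1)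
  rw [lt_div_iff₀ hr] at hQ
  have hcontr : ∀ z ∈ Metric.ball c r, ∀ q, dist (f^[p * q] z) c ≤ (1 / 2) ^ q * dist z c := by
    intro z hz q
    induction q with
    | zero => simp
    | succ q ih =>
      have hz' : dist z c < r := hz
      have hle : ((1 : ℝ) / 2) ^ q ≤ 1 := pow_le_one₀ (by norm_num) (by norm_num)
      have h2 : dist (f^[p * q] z) c < r :=
        (ih.trans (mul_le_of_le_one_left dist_nonneg hle)).trans_lt hz'
      rw [Nat.mul_succ, add_comm, Function.iterate_add_apply, pow_succ]
      linarith [hball h2]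
  have hmain : ∀ n z, z ∈ Metric.ball c r → f^[n] z = x → n < p * Q := by
    intro n z hz hn
    by_contra hlt
    have hq : Q ≤ n / p := (Nat.le_div_iff_mul_le hp).mpr (by rw [mul_comm]; omega)
    refine hne (y := f^[p * (n / p)] z) ?_ (n % p) (Finset.mem_range.mpr (Nat.mod_lt n hp)) ?_
    · refine (hcontr z hz _).trans_lt (lt_of_le_of_lt ?_ hQ)
      have hz' : dist z c < r := hz
      exact mul_le_mul (pow_le_pow_of_le_one (by norm_num) (by norm_num) hq) hz'.le dist_nonneg
        (by positivity)
    · rw [← Function.iterate_add_apply, Nat.mod_add_div, hn]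
  refine ⟨Metric.ball c r, Metric.ball_mem_nhds c hr, p * Q, fun n z hz => ?_⟩
  have h3 : {k | k < n ∧ f^[k] z ∈ Metric.ball c r} ⊆ Finset.Ico (n - p * Q) n := by
    rintro k ⟨hk, hkb⟩
    have := hmain (n - k) _ hkb (by
      rw [← Function.iterate_add_apply, Nat.sub_add_cancel hk.le, hz])
    simp only [Finset.coe_Ico, Set.mem_Ico]
    omega
  refine (Set.ncard_le_ncard h3 (Finset.finite_toSet _)).trans ?_
  rw [Set.ncard_coe_finset, Nat.card_Ico]
  omega

/-- Neighbourhoods of a finite set, each of whose points is either not periodic or attracting and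
with an orbit that avoids `x`, are visited by the backward orbits of `x` with small frequency. -/
lemma exists_nhds_visitCount_le_mul_add {X : Type*} [MetricSpace X] {f : X → X}
    (hf : Continuous f) {x : X} {K : Set X} (hK : K.Finite)
    (h : ∀ c ∈ K, c ∈ Function.periodicPts f → (∀ k, f^[k] c ≠ x) ∧
      ∃ p > 0, ∀ᶠ z in 𝓝 c, dist (f^[p] z) c ≤ dist z c / 2) {ε : ℝ} (hε : 0 < ε) :
    ∃ (U : Set X) (C : ℕ), IsOpen U ∧ K ⊆ U ∧
      ∀ n z, f^[n] z = x → (visitCount f U n z : ℝ) ≤ ε * n + C := by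
  obtain ⟨K, rfl⟩ := hK.exists_finset_coe
  -- The `+ 1` keeps `T` positive when `K` is empty.
  obtain ⟨T, hT⟩ := exists_nat_gt ((K.card + 1) / ε)
  have hT0 : (0 : ℝ) < T := lt_trans (by positivity) hT
  have hKT : (K.card : ℝ) / T ≤ ε := by
    rw [div_lt_iff₀ hε] at hT
    rw [div_le_iff₀ hT0]
    linarith
  have key : ∀ c : X, ∃ (V : Set X) (C : ℕ), IsOpen V ∧ c ∈ V ∧ (c ∈ K → ∀ n z, f^[n] z = x →
      visitCount f V n z ≤ n / T + C) := by
    intro c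
    have hmono : ∀ {U V : Set X}, V ⊆ U → ∀ n z, visitCount f V n z ≤ visitCount f U n z :=
      fun hVU n z => Set.ncard_le_ncard (fun k hk => ⟨hk.1, hVU hk.2⟩) (finite_visits f _ n z)
    by_cases hcK : c ∈ K
    · by_cases hper : c ∈ Function.periodicPts f
      · obtain ⟨hx, p, hp, hattr⟩ := h c hcK hper
        obtain ⟨U, hU, C, hC⟩ := exists_nhds_visitCount_le_of_attracting hf hp hattr hx
        obtain ⟨V, hVU, hV, hcV⟩ := mem_nhds_iff.mp hU
        exact ⟨V, C, hV, hcV, fun _ n z hz =>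
          ((hmono hVU n z).trans (hC n z hz)).trans (Nat.le_add_left _ _)⟩
      · obtain ⟨U, hU, hC⟩ := exists_nhds_visitCount_le_of_not_periodic hf hper
          (T := T) (by exact_mod_cast hT0)
        obtain ⟨V, hVU, hV, hcV⟩ := mem_nhds_iff.mp hU
        exact ⟨V, 1, hV, hcV, fun _ n z _ => (hmono hVU n z).trans (hC n z)⟩
    · exact ⟨Set.univ, 0, isOpen_univ, trivial, fun h => absurd h hcK⟩
  choose V C hVo hcV hVC using key
  refine ⟨⋃ c ∈ K, V c, ∑ c ∈ K, C c, isOpen_biUnion fun c _ => hVo c, fun c hc =>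
    Set.mem_biUnion hc (hcV c), fun n z hz => ?_⟩
  have h1 : visitCount f (⋃ c ∈ K, V c) n z ≤ ∑ c ∈ K, (n / T + C c) :=
    (visitCount_biUnion_le f K V n z).trans (Finset.sum_le_sum fun c hc => hVC c hc n z hz)
  rw [Finset.sum_add_distrib, Finset.sum_const, smul_eq_mul] at h1
  have h2 : (visitCount f (⋃ c ∈ K, V c) n z : ℝ) ≤
      K.card * ((n / T : ℕ) : ℝ) + ((∑ c ∈ K, C c : ℕ) : ℝ) := by exact_mod_cast h1
  refine h2.trans (add_le_add_left ?_ _)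
  calc (K.card : ℝ) * ((n / T : ℕ) : ℝ) ≤ K.card * (n / T) := by gcongr; exact Nat.cast_div_le
    _ = K.card / T * n := by ring
    _ ≤ ε * n := by gcongr

/-! ### Holomorphic maps with finite fibres -/

/-- A map with finite fibre through `a` is not locally constant at `a`. -/
lemma not_eventually_const_of_finite_fibre {g : ℂ → ℂ} {W' : Set ℂ} (hW' : IsOpen W') {a : ℂ}
    (ha : a ∈ W') (hfin : {z ∈ W' | g z = g a}.Finite) : ¬ ∀ᶠ z in 𝓝 a, g z = g a := fun h =>
  (infinite_of_mem_nhds a (inter_mem (hW'.mem_nhds ha) h)) hfin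

lemma isOpen_image_of_not_eventually_const {g : ℂ → ℂ} {W' A : Set ℂ} (hg : AnalyticOnNhd ℂ g W')
    (hconst : ∀ a ∈ W', ¬ ∀ᶠ z in 𝓝 a, g z = g a) (hAW' : A ⊆ W') (hA : IsOpen A) :
    IsOpen (g '' A) := isOpen_iff_mem_nhds.mpr <| by
  rintro _ ⟨z, hz, rfl⟩
  exact (hg z (hAW' hz)).eventually_constant_or_nhds_le_map_nhds.resolve_left (hconst z (hAW' hz))
    (image_mem_map (hA.mem_nhds hz))

/-- An accumulation point of critical points would make `g` locally constant there, hence give an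
infinite fibre. -/
lemma finite_setOf_deriv_eq_zero {g : ℂ → ℂ} {W' X : Set ℂ} (hX : IsCompact X) (hW' : IsOpen W')
    (hXW' : X ⊆ W') (hg : AnalyticOnNhd ℂ g W') (hfin : ∀ a ∈ X, {z ∈ W' | g z = g a}.Finite) :
    {c ∈ X | deriv g c = 0}.Finite := by
  by_contra hinf
  obtain ⟨a, haX, ha⟩ := Set.Infinite.exists_accPt_of_subset_isCompact hinf hX
    (Set.sep_subset X _)
  have hga := hg a (hXW' haX)
  have h1 : ∃ᶠ z in 𝓝[≠] a, deriv g z = 0 :=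
    (accPt_iff_frequently_nhdsNE.mp ha).mono fun z hz => hz.2
  have h2 := analyticOrderAt_eq_top.mpr (hga.deriv.frequently_zero_iff_eventually_zero.mp h1)
  have h3 := hga.analyticOrderAt_deriv_add_one
  rw [h2, top_add] at h3
  refine not_eventually_const_of_finite_fibre hW' (hXW' haX) (hfin a haX) ?_
  filter_upwards [analyticOrderAt_eq_top.mp h3.symm] with z hz
  exact sub_eq_zero.mp hz

/-- A map which is locally injective at the points of a compact set separates the points of the
set with the same image uniformly. -/
lemma exists_le_dist_of_locally_injective {X Y : Type*} [MetricSpace X] {f : X → Y} {K : Set X}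
    (hK : IsCompact K) (h : ∀ z ∈ K, ∃ V ∈ 𝓝 z, Set.InjOn f V) :
    ∃ δ > 0, ∀ z ∈ K, ∀ z', f z = f z' → z ≠ z' → δ ≤ dist z z' := by
  have h' : ∀ z : K, ∃ V : Set X, IsOpen V ∧ ↑z ∈ V ∧ Set.InjOn f V := fun z => by
    obtain ⟨V, hV, hinj⟩ := h z z.2
    obtain ⟨V', h1, h2, h3⟩ := mem_nhds_iff.mp hV
    exact ⟨V', h2, h3, hinj.mono h1⟩
  choose V hVo hzV hinj using h'
  obtain ⟨δ, hδ, hball⟩ := lebesgue_number_lemma_of_metric hK hVo fun z hz =>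
    Set.mem_iUnion.mpr ⟨⟨z, hz⟩, hzV _⟩
  refine ⟨δ, hδ, fun z hz z' hf hne => not_lt.mp fun hlt => hne ?_⟩
  obtain ⟨i, hi⟩ := hball z hz
  exact hinj i (hi (Metric.mem_ball_self hδ)) (hi (by rwa [Metric.mem_ball, dist_comm])) hf

lemma ncard_eq_of_hasDegreeOver {g : ℂ → ℂ} {W' Y : Set ℂ} {N : ℕ} (hdeg : HasDegreeOver g W' Y N)
    (hg : AnalyticOnNhd ℂ g W') {y : ℂ} (hy : y ∈ Y)
    (hcrit : ∀ z ∈ W', g z = y → deriv g z ≠ 0) : {z ∈ W' | g z = y}.ncard = N := by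
  obtain ⟨hfin, hsum⟩ := hdeg y hy
  rw [← hsum, finsum_mem_congr rfl (g := fun _ => 1), finsum_mem_eq_finite_toFinset_sum _ hfin,
    Finset.sum_const, smul_eq_mul, mul_one, Set.ncard_eq_toFinset_card _ hfin]
  rintro z ⟨hz, rfl⟩
  simp [analyticOrderNatAt, (hg z hz).analyticOrderAt_sub_eq_one_of_deriv_ne_zero (hcrit z hz rfl)]

/-! ### Holomorphic roots and totally ramified fibres -/

/-- A continuous `N`-th root of a holomorphic function is holomorphic where it does not vanish. -/
lemma differentiableAt_of_pow_eq {G φ : ℂ → ℂ} {N : ℕ} (hN : N ≠ 0) {z : ℂ}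
    (hG : DifferentiableAt ℂ G z) (hφ : ContinuousAt φ z) (hz : φ z ≠ 0)
    (h : ∀ᶠ w in 𝓝 z, φ w ^ N = G w) : DifferentiableAt ℂ φ z := by
  have hd : HasStrictDerivAt (fun s : ℂ => s ^ N) (N * φ z ^ (N - 1)) (φ z) :=
    hasStrictDerivAt_pow N (φ z)
  have hd' : (N : ℂ) * φ z ^ (N - 1) ≠ 0 :=
    mul_ne_zero (Nat.cast_ne_zero.mpr hN) (pow_ne_zero _ hz)
  have h1 : φ =ᶠ[𝓝 z] fun w => hd.localInverse _ _ _ hd' (G w) := by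
    filter_upwards [h, hφ.eventually (hd.eventually_left_inverse hd')] with w hw hw'
    rw [← hw, hw']
  refine h1.differentiableAt_iff.mpr (DifferentiableAt.comp z ?_ hG)
  rw [← h.self_of_nhds]
  exact (hd.to_localInverse hd').hasDerivAt.differentiableAt

lemma isProperMap_pow_add {N : ℕ} (hN : N ≠ 0) (y : ℂ) : IsProperMap fun s : ℂ => s ^ N + y := by
  have h : IsProperMap fun s : ℂ => s ^ N := by
    rw [isProperMap_iff_tendsto_cocompact]
    refine ⟨by fun_prop, ?_⟩
    rw [← Metric.cobounded_eq_cocompact, ← tendsto_norm_atTop_iff_cobounded]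
    simp only [norm_pow]
    exact (tendsto_pow_atTop hN).comp tendsto_norm_cobounded_atTop
  exact (Homeomorph.addRight y).isProperMap.comp h

lemma isOpenMap_pow_add {N : ℕ} (hN : N ≠ 0) (y : ℂ) : IsOpenMap fun s : ℂ => s ^ N + y := by
  have h : AnalyticOnNhd ℂ (fun s : ℂ => s ^ N + y) Set.univ :=
    (by fun_prop : Differentiable ℂ fun s : ℂ => s ^ N + y).differentiableOn.analyticOnNhd
      isOpen_univ
  refine h.is_constant_or_isOpenMap.resolve_left ?_
  rintro ⟨w, hw⟩
  have h0 := hw 0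
  have h1 := hw 1
  simp only [zero_pow hN, one_pow] at h0 h1
  exact one_ne_zero (add_right_cancel (h1.trans h0.symm))

/-- A holomorphic function on a simply connected domain with a single zero, of order `N`, has a
holomorphic `N`-th root. -/
lemma exists_differentiableOn_pow_eq {G : ℂ → ℂ} {W' : Set ℂ} {N : ℕ} (hN : N ≠ 0)
    (hW' : IsOpen W') (hsc : IsSimplyConnected W') (hG : DifferentiableOn ℂ G W') {a : ℂ}
    (ha : a ∈ W') (hzero : ∀ z ∈ W', G z = 0 → z = a) (hord : analyticOrderNatAt G a = N) :
    ∃ φ : ℂ → ℂ, DifferentiableOn ℂ φ W' ∧ ∀ z ∈ W', φ z ^ N = G z := by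
  have hGa : AnalyticAt ℂ G a := hG.analyticAt (hW'.mem_nhds ha)
  have htop : analyticOrderAt G a ≠ ⊤ := fun h => hN (by simp [← hord, analyticOrderNatAt, h])
  obtain ⟨u₀, hu₀, hu₀a, hGu₀⟩ := (hGa.analyticOrderNatAt_eq_iff htop).mp hord
  have hGa0 : G a = 0 := by simpa [hN] using hGu₀.self_of_nhds
  -- `u` is `G / (z - a) ^ N` with the singularity at `a` removed; it has no zeros on `W'`, so it
  -- has a continuous `N`-th root.
  set u : ℂ → ℂ := Function.update (fun z => G z / (z - a) ^ N) a (u₀ a) with hu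
  have hua : u a = u₀ a := Function.update_self ..
  have hu' : ∀ z, z ≠ a → u z = G z / (z - a) ^ N := fun z hz => Function.update_of_ne hz ..
  have huu₀ : u =ᶠ[𝓝 a] u₀ := by
    filter_upwards [hGu₀] with z hz
    by_cases hza : z = a
    · rw [hza, hua]
    · rw [hu' z hza, hz, smul_eq_mul, mul_div_cancel_left₀ _ (pow_ne_zero _ (sub_ne_zero.mpr hza))]
  have hGu : ∀ z, G z = (z - a) ^ N * u z := fun z => by
    by_cases hza : z = a
    · simp [hza, hGa0, hN]
    · rw [hu' z hza, mul_div_cancel₀ _ (pow_ne_zero _ (sub_ne_zero.mpr hza))]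
  have huc : ContinuousOn u W' := by
    refine fun z hz => ContinuousAt.continuousWithinAt ?_
    by_cases hza : z = a
    · rw [hza]
      exact hu₀.continuousAt.congr huu₀.symm
    · have h1 : (fun z => G z / (z - a) ^ N) =ᶠ[𝓝 z] u := by
        filter_upwards [isOpen_ne.mem_nhds hza] with w hw
        rw [hu' w hw]
      refine ContinuousAt.congr ?_ h1
      exact (hG.continuousOn.continuousAt (hW'.mem_nhds hz)).div (by fun_prop)
        (pow_ne_zero _ (sub_ne_zero.mpr hza))
  have hu0 : ∀ z ∈ W', u z ≠ 0 := fun z hz h => by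
    have hza := hzero z hz (by rw [hGu, h, mul_zero])
    rw [hza, hua] at h
    exact hu₀a h
  obtain ⟨v, hvc, hv⟩ := Complex.exists_continuousOn_pow_eq hsc hW' huc
    (by rintro ⟨z, hz, h⟩; exact hu0 z hz h) hN
  have hφG : ∀ z, ((z - a) * v z) ^ N = G z := fun z => by rw [mul_pow, hv, hGu]
  have hφc : ContinuousOn (fun z => (z - a) * v z) W' := by fun_prop
  refine ⟨fun z => (z - a) * v z, ?_, fun z _ => hφG z⟩
  -- Local inversion of the power fails at the zero `a`; continuity makes that singularity
  -- removable.
  refine (Complex.differentiableOn_compl_singleton_and_continuousAt_iff (hW'.mem_nhds ha)).mp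
    ⟨?_, hφc.continuousAt (hW'.mem_nhds ha)⟩
  rintro z ⟨hz, hza⟩
  refine (differentiableAt_of_pow_eq hN (hG.differentiableAt (hW'.mem_nhds hz))
    (hφc.continuousAt (hW'.mem_nhds hz)) ?_ (Eventually.of_forall hφG)).differentiableWithinAt
  exact mul_ne_zero (sub_ne_zero.mpr hza) fun h => hu0 z hz (by rw [← hv, h, zero_pow hN])

/-- A proper holomorphic map of degree `N ≥ 2` from a simply connected domain to a connected one
has at most one totally ramified fibre. -/
lemma eq_of_totally_ramified {g : ℂ → ℂ} {W' W : Set ℂ} {N : ℕ} (hN : 2 ≤ N)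
    (hW' : IsOpen W') (hsc : IsSimplyConnected W') (hW : IsPreconnected W)
    (hg : DifferentiableOn ℂ g W') (hmaps : Set.MapsTo g W' W)
    (hprop : IsProperMap (hmaps.restrict g W' W))
    (hfin : ∀ a ∈ W', {z ∈ W' | g z = g a}.Finite)
    {x₁ x₂ : ℂ} (hx₁ : x₁ ∈ W') (hx₂ : x₂ ∈ W') (h₁ : ∀ z ∈ W', g z = g x₁ → z = x₁)
    (h₂ : ∀ z ∈ W', g z = g x₂ → z = x₂)
    (hord : analyticOrderNatAt (fun w => g w - g x₁) x₁ = N) : x₁ = x₂ := by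
  by_contra hne
  have hN0 : N ≠ 0 := by omega
  obtain ⟨φ, hφ, hφg⟩ := exists_differentiableOn_pow_eq hN0 hW' hsc
    (hg.sub (differentiableOn_const (g x₁))) hx₁
    (fun z hz h => h₁ z hz (sub_eq_zero.mp h)) hord
  have hφg' : ∀ z ∈ W', φ z ^ N + g x₁ = g z := fun z hz => by
    rw [hφg z hz, Pi.sub_apply, sub_add_cancel]
  set p : ℂ → ℂ := fun s => s ^ N + g x₁ with hp
  let φ' : W' → p ⁻¹' W := fun z => ⟨φ z, by
    rw [Set.mem_preimage, show p (φ z) = g z from hφg' z z.2]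
    exact hmaps z.2⟩
  have hφ'c : Continuous φ' := (continuousOn_iff_continuous_domRestrict.mp hφ.continuousOn).subtype_mk _
  have hcomp : W.restrictPreimage p ∘ φ' = hmaps.restrict g W' W := by
    ext z
    exact hφg' z z.2
  have hpp := (isProperMap_pow_add hN0 (g x₁)).restrictPreimage W
  have hφ'p : IsProperMap φ' := isProperMap_of_comp_of_t2 hφ'c hpp.continuous (hcomp ▸ hprop)
  have hφ'o : IsOpen (Set.range φ') := by
    have h3 : IsOpen (φ '' W') := by
      refine isOpen_image_of_not_eventually_const (hφ.analyticOnNhd hW') (fun z hz h => ?_) le_rfl hW'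
      refine not_eventually_const_of_finite_fibre hW' hz (hfin z hz) ?_
      filter_upwards [h, hW'.mem_nhds hz] with w hw hwW
      rw [← hφg' w hwW, hw, hφg' z hz]
    convert h3.preimage continuous_subtype_val
    ext s
    simp [φ', Subtype.ext_iff]
  -- The range of `φ'` is open and closed, and `p` is both open and closed over `W`.
  have hclopen : IsClopen (W.restrictPreimage p '' (Set.range φ')ᶜ) :=
    ⟨hpp.isClosedMap _ hφ'o.isClosed_compl, (isOpenMap_pow_add hN0 (g x₁)).restrictPreimage W _
      hφ'p.isClosedMap.isClosed_range.isOpen_compl⟩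
  have : PreconnectedSpace W := isPreconnected_iff_preconnectedSpace.mp hW
  have hφx₂ : φ x₂ ≠ 0 := fun h => hne (h₁ x₂ hx₂ (by
    rw [← hφg' x₂ hx₂, h, zero_pow hN0, zero_add])).symm
  have hnonempty : (W.restrictPreimage p '' (Set.range φ')ᶜ).Nonempty := by
    -- `ζ * φ x₂` is missed by `φ`: it lies over `g x₂`, whose only preimage under `g` is `x₂`.
    have hζ := Complex.isPrimitiveRoot_exp N hN0
    set ζ := Complex.exp (2 * Real.pi * Complex.I / N) with hζdef
    have hpζ : p (ζ * φ x₂) = g x₂ := by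
      rw [hp]
      dsimp only
      rw [mul_pow, hζ.pow_eq_one, one_mul, hφg' x₂ hx₂]
    refine Set.Nonempty.image _ ⟨⟨ζ * φ x₂, ?_⟩, ?_⟩
    · rw [Set.mem_preimage, hpζ]
      exact hmaps hx₂
    · rintro ⟨z, hz⟩
      have hz' : φ z = ζ * φ x₂ := congrArg Subtype.val hz
      have hzx : (z : ℂ) = x₂ := h₂ z z.2 (by rw [← hφg' z z.2, hz']; exact hpζ)
      rw [hzx] at hz'
      exact hζ.ne_one (by omega) (mul_right_cancel₀ hφx₂ (by rw [one_mul, ← hz']))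
  -- So some point over `g x₁` would be missed too, but the only one is `0 = φ x₁`.
  have hmem : (⟨g x₁, hmaps hx₁⟩ : W) ∈ W.restrictPreimage p '' (Set.range φ')ᶜ :=
    hclopen.eq_univ hnonempty ▸ Set.mem_univ _
  obtain ⟨s, hs, hsx⟩ := hmem
  have hs0 : (s : ℂ) ^ N + g x₁ = g x₁ := congrArg Subtype.val hsx
  rw [add_eq_right, pow_eq_zero_iff hN0] at hs0
  have hφx₁ : φ x₁ = 0 := by
    have := hφg' x₁ hx₁
    rwa [add_eq_right, pow_eq_zero_iff hN0] at this
  exact hs ⟨⟨x₁, hx₁⟩, Subtype.ext (hφx₁.trans hs0.symm)⟩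

/-- A proper holomorphic map with finite fibres to a connected set maps each component of its
domain onto that set. -/
lemma exists_mem_connectedComponentIn_eq {g : ℂ → ℂ} {W' W : Set ℂ}
    (hW' : IsOpen W') (hW : IsPreconnected W) (hg : DifferentiableOn ℂ g W')
    (hmaps : Set.MapsTo g W' W) (hprop : IsProperMap (hmaps.restrict g W' W))
    (hfin : ∀ a ∈ W', {z ∈ W' | g z = g a}.Finite) {z y : ℂ} (hz : z ∈ W') (hy : y ∈ W) :
    ∃ x ∈ connectedComponentIn W' z, g x = y := by
  have : LocallyConnectedSpace W' := hW'.locallyConnectedSpace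
  have : PreconnectedSpace W := isPreconnected_iff_preconnectedSpace.mp hW
  set U := connectedComponent (⟨z, hz⟩ : W')
  have hopen : IsOpenMap (hmaps.restrict g W' W) := by
    intro V hV
    have h1 := isOpen_image_of_not_eventually_const (hg.analyticOnNhd hW')
      (fun a ha => not_eventually_const_of_finite_fibre hW' ha (hfin a ha))
      (Subtype.coe_image_subset W' V) (hW'.isOpenMap_subtype_val V hV)
    convert h1.preimage continuous_subtype_val
    ext w
    simp [Subtype.ext_iff]
  have hcl : IsClopen (hmaps.restrict g W' W '' U) :=
    ⟨hprop.isClosedMap _ isClosed_connectedComponent, hopen _ isOpen_connectedComponent⟩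
  have hmem : (⟨y, hy⟩ : W) ∈ hmaps.restrict g W' W '' U :=
    hcl.eq_univ ⟨_, Set.mem_image_of_mem _ mem_connectedComponent⟩ ▸ Set.mem_univ _
  obtain ⟨x, hx, hxy⟩ := hmem
  refine ⟨x, ?_, congrArg Subtype.val hxy⟩
  rw [connectedComponentIn_eq_image hz]
  exact Set.mem_image_of_mem _ hx

/-! ### Critical cycles and the two entropy bounds -/

lemma differentiableAt_iterate {g : ℂ → ℂ} {X : Set ℂ} (hmaps : Set.MapsTo g X X)
    (hg : ∀ x ∈ X, DifferentiableAt ℂ g x) (n : ℕ) : ∀ x ∈ X, DifferentiableAt ℂ g^[n] x := by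
  induction n with
  | zero => exact fun x _ => differentiableAt_id
  | succ n ih => exact fun x hx => (ih (g x) (hmaps hx)).comp x (hg x hx)

/-- A cycle through a critical point is attracting. -/
lemma eventually_dist_iterate_le_of_deriv_eq_zero {g : ℂ → ℂ} {X : Set ℂ} {f : X → X}
    (hg : ∀ x ∈ X, DifferentiableAt ℂ g x) (hext : ∀ x : X, g (x : ℂ) = (f x : ℂ)) {c : X}
    (hc : deriv g (c : ℂ) = 0) {p : ℕ} (hp : 0 < p) (hpc : f^[p] c = c) :
    ∀ᶠ z in 𝓝 c, dist (f^[p] z) c ≤ dist z c / 2 := by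
  have hmaps : Set.MapsTo g X X := fun x hx => hext ⟨x, hx⟩ ▸ (f ⟨x, hx⟩).2
  have hiter : ∀ (n : ℕ) (x : X), g^[n] (x : ℂ) = (f^[n] x : ℂ) := fun n x =>
    ((show Function.Semiconj Subtype.val f g from fun x => (hext x).symm).iterate_right n x).symm
  obtain ⟨p, rfl⟩ : ∃ q, p = q + 1 := ⟨p - 1, by omega⟩
  have h1 : HasDerivAt g^[p + 1] 0 (c : ℂ) := by
    have h2 := (differentiableAt_iterate hmaps hg p (g c) (hmaps c.2)).hasDerivAt.comp (c : ℂ)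
      (hg c c.2).hasDerivAt
    rw [hc, mul_zero] at h2
    exact h2
  have h3 := (hasDerivAt_iff_isLittleO.mp h1).def (half_pos one_pos)
  filter_upwards [continuous_subtype_val.continuousAt.eventually h3] with z hz
  rw [smul_zero, sub_zero, hiter, hiter, hpc] at hz
  rw [Subtype.dist_eq, Subtype.dist_eq, dist_eq_norm, dist_eq_norm]
  linarith

/-- If a holomorphic map has degree `N` over its completely invariant compact set `X`, and `X` is
not a union of cycles through critical points, then the entropy on `X` is at least `log N`. -/
lemma log_le_coverEntropy_of_unionOfCriticalCycles_ne_univ {X : Set ℂ} (hX : IsCompact X)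
    {f : X → X} (hf : Continuous f) {W' : Set ℂ} (hW' : IsOpen W') (hXW' : X ⊆ W')
    {g : ℂ → ℂ} (hg : AnalyticOnNhd ℂ g W') (hext : ∀ x : X, g (x : ℂ) = (f x : ℂ))
    (hpre : {z ∈ W' | g z ∈ X} = X) {N : ℕ} (hN : 2 ≤ N) (hdeg : HasDegreeOver g W' X N)
    (hne : unionOfCriticalCycles f g ≠ Set.univ) :
    ((Real.log N : ℝ) : EReal) ≤ Dynamics.coverEntropy f Set.univ := by
  have : CompactSpace X := isCompact_iff_compactSpace.mp hX
  have hgX : ∀ x ∈ X, g x ∈ X := fun x hx => hext ⟨x, hx⟩ ▸ (f ⟨x, hx⟩).2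
  have hXmem : ∀ z ∈ W', g z ∈ X → z ∈ X := fun z hz hgz => hpre ▸ ⟨hz, hgz⟩
  obtain ⟨x, hx⟩ := (Set.ne_univ_iff_exists_notMem _).mp hne
  have hcrit : {c : X | deriv g c = 0}.Finite := by
    refine Set.Finite.of_finite_image ((finite_setOf_deriv_eq_zero hX hW' hXW' hg fun a ha =>
      (hdeg (g a) (hgX a ha)).1).subset ?_) Subtype.val_injective.injOn
    rintro _ ⟨c, hc, rfl⟩
    exact ⟨c.2, hc⟩
  refine log_le_coverEntropy f hN x fun ε hε => ?_
  obtain ⟨U, C, hU, hcU, hvisit⟩ := exists_nhds_visitCount_le_mul_add hf (x := x) hcrit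
    (fun c hc hper => ⟨fun k hk => hx ⟨c, hc, hper, k, hk⟩, by
      obtain ⟨p, hp, hpc⟩ := hper
      exact ⟨p, hp, eventually_dist_iterate_le_of_deriv_eq_zero
        (fun x hx => (hg x (hXW' hx)).differentiableAt) hext hc hp hpc⟩⟩) hε
  refine ⟨U, C, hvisit, ?_⟩
  obtain ⟨δ, hδ, hsep⟩ := exists_le_dist_of_locally_injective (f := f) hU.isClosed_compl.isCompact
    fun z hz => by
      have h1 := (hg z (hXW' z.2)).hasStrictDerivAt
      have h2 : deriv g (z : ℂ) ≠ 0 := fun h => hz (hcU h)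
      refine ⟨_, continuous_subtype_val.continuousAt.eventually (h1.eventually_left_inverse h2),
        fun a ha b hb hab => Subtype.ext ?_⟩
      rw [← ha, ← hb, hext, hext, hab]
  refine ⟨δ, hδ, fun y => or_iff_not_imp_left.mpr fun hy => ?_⟩
  have hfin : {z : X | f z = y}.Finite := by
    refine Set.Finite.of_finite_image ((hdeg y y.2).1.subset ?_) Subtype.val_injective.injOn
    rintro _ ⟨z, rfl, rfl⟩
    exact ⟨hXW' z.2, hext z⟩
  refine ⟨hfin.toFinset, ?_, fun z hz => by simpa using hz, fun z hz z' hz' hzz' => ?_⟩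
  -- All preimages of `y` in `W'` lie in `X`, and outside `U` none is critical, so each has
  -- multiplicity one.
  · rw [← Set.ncard_eq_toFinset_card _ hfin, ← Set.ncard_image_of_injective _
      Subtype.val_injective, ← ncard_eq_of_hasDegreeOver hdeg hg y.2]
    · congr 1
      ext z
      constructor
      · rintro ⟨z, rfl, rfl⟩
        exact ⟨hXW' z.2, hext z⟩
      · rintro ⟨hz, hzy⟩
        have hzX := hXmem z hz (hzy ▸ y.2)
        exact ⟨⟨z, hzX⟩, Subtype.ext ((hext _).symm.trans hzy), rfl⟩
    · intro z hz hzy hd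
      have hzX := hXmem z hz (hzy ▸ y.2)
      exact hy ⟨⟨z, hzX⟩, hcU hd, Subtype.ext ((hext _).symm.trans hzy)⟩
  · simp only [Set.Finite.mem_toFinset, Set.mem_ofPred_eq] at hz hz'
    exact hsep z (fun h => hy ⟨z, h, hz⟩) z' (hz.trans hz'.symm) hzz'

/-- All points are periodic, so two points with the same image are recovered from it by the same
iterate, one less than a common period. -/
lemma injective_of_unionOfCriticalCycles_eq_univ {X : Set ℂ} {f : X → X} {g : ℂ → ℂ}
    (h : unionOfCriticalCycles f g = Set.univ) : Function.Injective f := by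
  have hper : ∀ x, x ∈ Function.periodicPts f := fun x => by
    obtain ⟨c, -, ⟨p, hp, hc⟩, k, rfl⟩ := h ▸ Set.mem_univ x
    exact ⟨p, hp, hc.apply_iterate k⟩
  intro a b hab
  obtain ⟨p, hp, ha⟩ := hper a
  obtain ⟨q, hq, hb⟩ := hper b
  obtain ⟨m, hm⟩ : ∃ m, p * q = m + 1 := ⟨p * q - 1, by have := Nat.mul_pos hp hq; omega⟩
  have ha' := (ha.mul_const q).eq
  have hb' := (hb.const_mul p).eq
  rw [hm, Function.iterate_succ_apply] at ha' hb'
  rw [← ha', ← hb', hab]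

/-- If some fibre of a proper holomorphic map to a connected set is a single point, then the domain
of the map is connected. -/
lemma connectedComponentIn_eq_of_unique_preimage {g : ℂ → ℂ} {W' W : Set ℂ}
    (hW' : IsOpen W') (hW : IsPreconnected W) (hg : DifferentiableOn ℂ g W')
    (hmaps : Set.MapsTo g W' W) (hprop : IsProperMap (hmaps.restrict g W' W))
    (hfin : ∀ a ∈ W', {z ∈ W' | g z = g a}.Finite) {c : ℂ} (hc : c ∈ W')
    (huniq : ∀ z ∈ W', g z = g c → z = c) : connectedComponentIn W' c = W' := by
  refine (connectedComponentIn_subset W' c).antisymm fun z hz => ?_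
  obtain ⟨x, hx, hxc⟩ := exists_mem_connectedComponentIn_eq hW' hW hg hmaps hprop hfin hz
    (hmaps hc)
  rw [huniq x (connectedComponentIn_subset W' z hx) hxc] at hx
  rw [← connectedComponentIn_eq hx]
  exact mem_connectedComponentIn hz

theorem theoremA1 (X : Set ℂ) (hX : IsCompact X) (hXne : X.Nonempty)
    (f : X → X) (hf : Continuous f)
    (W' W : Set ℂ) (hW' : IsOpen W') (hW : IsOpen W) (hXW' : X ⊆ W') (hXW : X ⊆ W)
    (g : ℂ → ℂ) (hg : DifferentiableOn ℂ g W') (hmaps : Set.MapsTo g W' W)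
    (hext : ∀ x : X, g (x : ℂ) = (f x : ℂ))
    (hpre : {z ∈ W' | g z ∈ X} = X)
    (N : ℕ) (hN : 2 ≤ N) (hdeg : HasDegreeOver g W' X N) :
    (unionOfCriticalCycles f g ≠ Set.univ →
      ((Real.log N : ℝ) : EReal) ≤ Dynamics.coverEntropy f Set.univ) ∧
    (IsProperMap (hmaps.restrict g W' W) → HasDegreeOver g W' W N →
      IsSimplyConnected W → HasFinitelyManySimplyConnectedComponents W' →
      ((Real.log N : ℝ) : EReal) ≤ Dynamics.coverEntropy f Set.univ ∨
        (IsConnected W' ∧ IsSimplyConnected W' ∧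
          ∃ c : ℂ, X = {c} ∧ g c = c ∧ deriv g c = 0 ∧
            analyticOrderNatAt (fun w => g w - g c) c = N)) := by
  have hga : AnalyticOnNhd ℂ g W' := hg.analyticOnNhd hW'
  refine ⟨log_le_coverEntropy_of_unionOfCriticalCycles_ne_univ hX hf hW' hXW' hga hext hpre hN hdeg,
    fun hprop hdegW hscW hcomp => or_iff_not_imp_left.mpr fun hent => ?_⟩
  have huniv : unionOfCriticalCycles f g = Set.univ := by
    by_contra hne
    exact hent (log_le_coverEntropy_of_unionOfCriticalCycles_ne_univ hX hf hW' hXW' hga hext hpre hN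
      hdeg hne)
  have hinj := injective_of_unionOfCriticalCycles_eq_univ huniv
  have hgX : ∀ x ∈ X, g x ∈ X := fun x hx => hext ⟨x, hx⟩ ▸ (f ⟨x, hx⟩).2
  have huniq : ∀ x ∈ X, ∀ z ∈ W', g z = g x → z = x := fun x hx z hz hzx => by
    have hzX : z ∈ X := hpre ▸ ⟨hz, hzx ▸ hgX x hx⟩
    have h1 : f ⟨z, hzX⟩ = f ⟨x, hx⟩ := Subtype.ext (by rw [← hext, ← hext]; exact hzx)
    exact congrArg Subtype.val (hinj h1)
  have hord : ∀ x ∈ X, analyticOrderNatAt (fun w => g w - g x) x = N := fun x hx => by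
    have h1 : {z ∈ W' | g z = g x} = {x} := Set.Subset.antisymm
      (fun z hz => huniq x hx z hz.1 hz.2) (by rintro _ rfl; exact ⟨hXW' hx, rfl⟩)
    rw [← (hdeg (g x) (hgX x hx)).2, h1, finsum_mem_singleton]
  have hfin : ∀ a ∈ W', {z ∈ W' | g z = g a}.Finite := fun a ha => (hdegW (g a) (hmaps ha)).1
  have hWc : IsPreconnected W := hscW.isPathConnected.isConnected.isPreconnected
  obtain ⟨c, hc⟩ := hXne
  have hcW' := hXW' hc
  have hconn : connectedComponentIn W' c = W' :=
    connectedComponentIn_eq_of_unique_preimage hW' hWc hg hmaps hprop hfin hcW' (huniq c hc)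
  have hscW' : IsSimplyConnected W' := hconn ▸ hcomp.2 c hcW'
  have hXc : ∀ x ∈ X, x = c := fun x hx => eq_of_totally_ramified hN hW' hscW' hWc hg hmaps hprop
    hfin (hXW' hx) hcW' (huniq x hx) (huniq c hc) (hord x hx)
  refine ⟨hscW'.isPathConnected.isConnected, hscW', c, Set.Subset.antisymm hXc (by simpa using hc),
    hXc _ (hgX c hc), ?_, hord c hc⟩
  by_contra hd
  have h1 := hord c hc
  rw [analyticOrderNatAt, (hga c hcW').analyticOrderAt_sub_eq_one_of_deriv_ne_zero hd] at h1
  simp at h1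
  omega
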